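/- Let $K$ be a field of characteristic zero and let $A$ be a commutative $K$-algebra. Suppose that either $A$ is finitely generated as a $K$-algebra, or $A$ is a complete local ring (that is, $A$ is local with maximal ideal $\mathfrak m$, and separated and complete in the $\mathfrak m$-adic topology). Let $D_{A|K}\subseteq \operatorname{End}_K(A)$ be the ring of $K$-linear differential operators on $A$ (in the sense of Grothendieck). Let $f_1,\dots,f_\ell\in A$, let $A_{f_1\cdots f_\ell}$ be the localization of $A$ at the powers of $f_1\cdots f_\ell$, and let $s_1,\dots,s_\ell$ be indeterminates, which commute with one another and with $D_{A|K}$ in the polynomial ring $D_{A|K}[s_1,\dots,s_\ell]$. Every $\delta\in D_{A|K}$ extends uniquely to a $K$-linear differential operator on $A_{f_1\cdots f_\ell}$, and this extension defines the action $\delta\bullet v$ of $D_{A|K}$ on $A_{f_1\cdots f_\ell}$. Let $$M^A[\mathbf f^{\mathbf s}] = A_{f_1\cdots f_\ell}[s_1,\dots,s_\ell]\; \boldsymbol{f_1^{s_1}}\cdots \boldsymbol{f_\ell^{s_\ell}}$$ be the free $A_{f_1\cdots f_\ell}[s_1,\dots,s_\ell]$-module of rank one on the formal symbol $\boldsymbol{f_1^{s_1}}\cdots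 \boldsymbol{f_\ell^{s_\ell}}$. For $t=(t_1,\dots,t_\ell)\in\mathbb Z^\ell$ let $\varphi_t\colon M^A[\mathbf f^{\mathbf s}]\to A_{f_1\cdots f_\ell}$ be the $A_{f_1\cdots f_\ell}$-linear map $$\varphi_t\bigl(h(s_1,\dots,s_\ell)\,\boldsymbol{f_1^{s_1}}\cdots \boldsymbol{f_\ell^{s_\ell}}\bigr)=h(t_1,\dots,t_\ell)\,f_1^{t_1}\cdots f_\ell^{t_\ell}.$$ Then there is a unique left $D_{A|K}[s_1,\dots,s_\ell]$-module structure on the additive group $M^A[\mathbf f^{\mathbf s}]$ such that $$\varphi_t(\delta\bullet v)=\delta(t)\bullet\varphi_t(v)$$ for all $v\in M^A[\mathbf f^{\mathbf s}]$, $\delta\in D_{A|K}[s_1,\dots,s_\ell]$ and $t\in\mathbb Z^\ell$, where $\delta(t)\in D_{A|K}$ is obtained from $\delta$ by substituting $s_i=t_i$. -/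

import Mathlib

namespace BernsteinSato

/-! ### Differential operators -/

section DiffOps

variable (K : Type*) {A : Type*} [Field K] [CommRing A] [Algebra K A]

/-- Multiplication by `a`, as a `K`-linear endomorphism of `A`. -/
def mulOp (a : A) : Module.End K A := Algebra.lmul K A a

@[simp] theorem mulOp_apply (a x : A) : mulOp K a x = a * x := rfl

/-- `IsDiffOp K m δ`: the `K`-linear map `δ : A → A` is a differential operator of order at most
`m`. Order zero means multiplication by an element; order at most `m + 1` means that all
commutators with multiplications have order at most `m`. -/
def IsDiffOp : ℕ → Module.End K A → Prop
  | 0, δ => ∃ a : A, δ = mulOp K a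
  | m + 1, δ => ∀ a : A, IsDiffOp m (δ * mulOp K a - mulOp K a * δ)

variable {K}

theorem mulOp_comm (a b : A) : mulOp K a * mulOp K b = mulOp K b * mulOp K a := by
  ext x; simp [mul_left_comm]

theorem IsDiffOp.zero (m : ℕ) : IsDiffOp K m (0 : Module.End K A) := by
  induction m with
  | zero => exact ⟨0, by ext x; simp⟩
  | succ m ih => intro a; simpa using ih

theorem IsDiffOp.succ {m : ℕ} {δ : Module.End K A} (h : IsDiffOp K m δ) :
    IsDiffOp K (m + 1) δ := by
  induction m generalizing δ with
  | zero =>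
    obtain ⟨a, rfl⟩ := h
    intro b
    rw [mulOp_comm, sub_self]
    exact IsDiffOp.zero 0
  | succ m ih => exact fun a => ih (h a)

theorem IsDiffOp.mono {m n : ℕ} (hmn : m ≤ n) {δ : Module.End K A} (h : IsDiffOp K m δ) :
    IsDiffOp K n δ := by
  induction hmn with
  | refl => exact h
  | step _ ih => exact ih.succ

theorem IsDiffOp.add {m : ℕ} {δ ε : Module.End K A} (h : IsDiffOp K m δ) (h' : IsDiffOp K m ε) :
    IsDiffOp K m (δ + ε) := by
  induction m generalizing δ ε with
  | zero =>
    obtain ⟨a, rfl⟩ := h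
    obtain ⟨b, rfl⟩ := h'
    exact ⟨a + b, by ext x; simp [add_mul]⟩
  | succ m ih =>
    intro a
    have := ih (h a) (h' a)
    convert this using 1
    noncomm_ring

theorem IsDiffOp.mul {m n : ℕ} {δ ε : Module.End K A} (h : IsDiffOp K m δ)
    (h' : IsDiffOp K n ε) : IsDiffOp K (m + n) (δ * ε) := by
  induction m generalizing n δ ε with
  | zero =>
    obtain ⟨b, rfl⟩ := h
    rw [Nat.zero_add]
    induction n generalizing ε with
    | zero =>
      obtain ⟨c, rfl⟩ := h'
      exact ⟨b * c, by ext x; simp [mul_assoc]⟩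
    | succ n ih =>
      intro a
      convert ih (h' a) using 1
      rw [mul_sub, ← mul_assoc, ← mul_assoc, ← mul_assoc, mulOp_comm a b]
  | succ m ihm =>
    induction n generalizing ε with
    | zero =>
      obtain ⟨b, rfl⟩ := h'
      intro a
      change IsDiffOp K (m + 0) _
      convert ihm (h a) (n := 0) ⟨b, rfl⟩ using 1
      rw [sub_mul, mul_assoc, mul_assoc, mul_assoc, mulOp_comm b a]
    | succ n ihn =>
      intro a
      have h1 : IsDiffOp K (m + 1 + n) (δ * (ε * mulOp K a - mulOp K a * ε)) := ihn (h' a)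
      have h2 : IsDiffOp K (m + 1 + n) ((δ * mulOp K a - mulOp K a * δ) * ε) :=
        (ihm (h a) h').mono (by omega)
      change IsDiffOp K (m + 1 + n) _
      convert h1.add h2 using 1
      simp only [mul_sub, sub_mul, mul_assoc]
      abel

variable (K A)

/-- The ring `D_{A|K}` of `K`-linear differential operators on `A`. -/
def diffOps : Subalgebra K (Module.End K A) where
  carrier := {δ | ∃ m, IsDiffOp K m δ}
  mul_mem' := by
    rintro δ ε ⟨m, hm⟩ ⟨n, hn⟩
    exact ⟨m + n, hm.mul hn⟩
  add_mem' := by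
    rintro δ ε ⟨m, hm⟩ ⟨n, hn⟩
    exact ⟨max m n, (hm.mono (le_max_left _ _)).add (hn.mono (le_max_right _ _))⟩
  algebraMap_mem' c := ⟨0, algebraMap K A c, by ext x; simp [Algebra.smul_def]⟩

end DiffOps

/-! ### Extension of differential operators to a localization

The auxiliary predicate `DiffLT` below (differential operators of order `< n` from `C` to a
`C`-algebra `N`) is only used to prove that a differential operator on `A` extends in exactly one
way to a differential operator on a localization of `A`. -/

section Localization

variable {K C N : Type*} [Field K] [CommRing C] [CommRing N] [Algebra K C] [Algebra K N]
  [Algebra C N]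

/-- The commutator of `δ` with multiplication by `c`. -/
def brk (δ : C →ₗ[K] N) (c : C) : C →ₗ[K] N :=
  δ ∘ₗ mulOp K c - mulOp K (algebraMap C N c) ∘ₗ δ

@[simp] theorem brk_apply (δ : C →ₗ[K] N) (c x : C) :
    brk δ c x = δ (c * x) - algebraMap C N c * δ x := rfl

/-- Auxiliary: `δ : C → N` is a differential operator of order `< n`. -/
def DiffLT : ℕ → (C →ₗ[K] N) → Prop
  | 0, δ => δ = 0
  | n + 1, δ => ∀ c : C, DiffLT n (brk δ c)

theorem DiffLT.zero (n : ℕ) : DiffLT n (0 : C →ₗ[K] N) := by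
  induction n with
  | zero => rfl
  | succ n ih =>
    intro c
    have : brk (0 : C →ₗ[K] N) c = 0 := by ext x; simp
    rw [this]; exact ih

theorem DiffLT.succ {n : ℕ} {δ : C →ₗ[K] N} (h : DiffLT n δ) : DiffLT (n + 1) δ := by
  induction n generalizing δ with
  | zero => cases h; exact DiffLT.zero 1
  | succ n ih => exact fun c => ih (h c)

theorem DiffLT.mono {m n : ℕ} (hmn : m ≤ n) {δ : C →ₗ[K] N} (h : DiffLT m δ) : DiffLT n δ := by
  induction hmn with
  | refl => exact h
  | step _ ih => exact ih.succ

theorem DiffLT.add {n : ℕ} {δ ε : C →ₗ[K] N} (h : DiffLT n δ) (h' : DiffLT n ε) :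
    DiffLT n (δ + ε) := by
  induction n generalizing δ ε with
  | zero => cases h; cases h'; exact add_zero _
  | succ n ih =>
    intro c
    have : brk (δ + ε) c = brk δ c + brk ε c := by ext x; simp; ring
    rw [this]; exact ih (h c) (h' c)

theorem DiffLT.mulLeft {n : ℕ} {δ : C →ₗ[K] N} (h : DiffLT n δ) (b : N) :
    DiffLT n (mulOp K b ∘ₗ δ) := by
  induction n generalizing δ with
  | zero => cases h; exact LinearMap.comp_zero _
  | succ n ih =>
    intro c
    have : brk (mulOp K b ∘ₗ δ) c = mulOp K b ∘ₗ brk δ c := by ext x; simp; ring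
    rw [this]; exact ih (h c)

theorem DiffLT.mulRight {n : ℕ} {δ : C →ₗ[K] N} (h : DiffLT n δ) (b : C) :
    DiffLT n (δ ∘ₗ mulOp K b) := by
  induction n generalizing δ with
  | zero => cases h; exact LinearMap.zero_comp _
  | succ n ih =>
    intro c
    have : brk (δ ∘ₗ mulOp K b) c = brk δ c ∘ₗ mulOp K b := by
      ext x; simp [mul_left_comm]
    rw [this]; exact ih (h c)

theorem DiffLT.smul {n : ℕ} {δ : C →ₗ[K] N} (h : DiffLT n δ) (k : K) : DiffLT n (k • δ) := by
  have : k • δ = mulOp K (algebraMap K N k) ∘ₗ δ := by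
    ext x; simp [Algebra.smul_def]
  rw [this]; exact h.mulLeft _

theorem DiffLT.sub {n : ℕ} {δ ε : C →ₗ[K] N} (h : DiffLT n δ) (h' : DiffLT n ε) :
    DiffLT n (δ - ε) := by
  have : δ - ε = δ + (-1 : K) • ε := by ext x; simp [sub_eq_add_neg]
  rw [this]; exact h.add (h'.smul _)

theorem isDiffOp_iff_diffLT {n : ℕ} {δ : Module.End K C} :
    IsDiffOp K n δ ↔ DiffLT (n + 1) δ := by
  induction n generalizing δ with
  | zero =>
    constructor
    · rintro ⟨a, rfl⟩ c
      change brk _ c = 0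
      ext x; simp [mul_left_comm]
    · intro h
      refine ⟨δ 1, ?_⟩
      ext x
      have := LinearMap.congr_fun (show brk δ x = 0 from h x) 1
      simp only [brk_apply, mul_one, Algebra.algebraMap_self, RingHom.id_apply,
        LinearMap.zero_apply, sub_eq_zero] at this
      rw [this, mulOp_apply, mul_comm]
  | succ n ih => exact forall_congr' fun a => ih

variable (K C N) in
/-- Auxiliary: all differential operators from `C` to `N`. -/
def diffTo : Submodule K (C →ₗ[K] N) where
  carrier := {δ | ∃ n, DiffLT n δ}
  add_mem' := by
    rintro δ ε ⟨m, hm⟩ ⟨n, hn⟩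
    exact ⟨max m n, (hm.mono (le_max_left _ _)).add (hn.mono (le_max_right _ _))⟩
  zero_mem' := ⟨0, rfl⟩
  smul_mem' k δ := by
    rintro ⟨n, hn⟩
    exact ⟨n, hn.smul k⟩

variable (K C N) in
/-- Auxiliary: `C` acts on differential operators by precomposition. -/
@[reducible] def precompModule : Module C (diffTo K C N) where
  smul c δ := ⟨δ.1 ∘ₗ mulOp K c, δ.2.imp fun _ h => h.mulRight c⟩
  one_smul δ := by
    apply Subtype.ext; ext x
    change δ.1 (1 * x) = _
    rw [one_mul]
  mul_smul a b δ := by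
    apply Subtype.ext; ext x
    change δ.1 (a * b * x) = δ.1 (b * (a * x))
    congr 1; ring
  smul_zero c := rfl
  smul_add c δ ε := rfl
  add_smul a b δ := by
    apply Subtype.ext; ext x
    change δ.1 ((a + b) * x) = δ.1 (a * x) + δ.1 (b * x)
    rw [add_mul, map_add]
  zero_smul δ := by
    apply Subtype.ext; ext x
    change δ.1 (0 * x) = 0
    rw [zero_mul, map_zero]

theorem precomp_injective {n : ℕ} {δ : C →ₗ[K] N} (h : DiffLT n δ) {s : C}
    (hs : IsUnit (algebraMap C N s)) (h0 : δ ∘ₗ mulOp K s = 0) : δ = 0 := by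
  induction n generalizing δ with
  | zero => exact h
  | succ n ih =>
    have h1 : brk δ s = 0 := ih (h s) (by
      ext x
      have h2 : ∀ y, δ (s * y) = 0 := fun y => LinearMap.congr_fun h0 y
      simp [h2])
    ext x
    have h2 := LinearMap.congr_fun h1 x
    have h3 : δ (s * x) = 0 := LinearMap.congr_fun h0 x
    simp only [brk_apply, h3, LinearMap.zero_apply, zero_sub, neg_eq_zero] at h2
    exact (hs.mul_right_eq_zero).1 h2

theorem precomp_surjective {n : ℕ} {δ : C →ₗ[K] N} (h : DiffLT n δ) {s : C}
    (hs : IsUnit (algebraMap C N s)) : ∃ ε : C →ₗ[K] N, DiffLT n ε ∧ ε ∘ₗ mulOp K s = δ := by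
  obtain ⟨u, hu⟩ := hs
  induction n generalizing δ with
  | zero => exact ⟨0, rfl, by rw [h]; rfl⟩
  | succ n ih =>
    obtain ⟨ε, hε, hε'⟩ := ih ((h s).mulLeft (↑u⁻¹ : N))
    refine ⟨mulOp K (↑u⁻¹ : N) ∘ₗ δ - ε, (h.mulLeft _).sub hε.succ, ?_⟩
    ext x
    have h1 := LinearMap.congr_fun hε' x
    simp only [LinearMap.comp_apply, mulOp_apply, brk_apply, ← hu] at h1
    simp only [LinearMap.comp_apply, LinearMap.sub_apply, mulOp_apply, h1]
    rw [mul_sub, sub_sub_cancel, ← mul_assoc, Units.inv_mul, one_mul]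

theorem extension_unique {A B : Type*} [CommRing A] [CommRing B] [Algebra K A] [Algebra K B]
    [Algebra A B] (S : Submonoid A) [IsLocalization S B] {n : ℕ} {E : B →ₗ[K] B}
    (h : DiffLT n E) (h0 : ∀ a : A, E (algebraMap A B a) = 0) : E = 0 := by
  induction n generalizing E with
  | zero => exact h
  | succ n ih =>
    ext x
    obtain ⟨a, s, rfl⟩ := IsLocalization.exists_mk'_eq S x
    have h1 : brk E (algebraMap A B s) = 0 := ih (h _) fun a => by
      rw [brk_apply, ← map_mul, h0, h0, mul_zero, sub_zero]
    have h2 := LinearMap.congr_fun h1 (IsLocalization.mk' B a s)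
    rw [brk_apply, IsLocalization.mk'_spec', h0, zero_sub, LinearMap.zero_apply, neg_eq_zero] at h2
    exact ((IsLocalization.map_units B s).mul_right_eq_zero).1 h2

theorem diffLT_of_brk_algebraMap {A B : Type*} [CommRing A] [CommRing B] [Algebra K A]
    [Algebra K B] [Algebra A B] (S : Submonoid A) [IsLocalization S B] {n : ℕ} {E : B →ₗ[K] B}
    (h : ∀ a : A, DiffLT n (brk E (algebraMap A B a))) : DiffLT (n + 1) E := by
  intro b
  obtain ⟨a, s, rfl⟩ := IsLocalization.exists_mk'_eq S b
  obtain ⟨u, hu⟩ := IsLocalization.map_units B s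
  have : brk E (IsLocalization.mk' B a s) = mulOp K (↑u⁻¹ : B) ∘ₗ
      (brk E (algebraMap A B a) -
        brk E (algebraMap A B s) ∘ₗ mulOp K (IsLocalization.mk' B a s)) := by
    have hb := IsLocalization.mk'_spec' B a s
    set b := IsLocalization.mk' B a s
    ext x
    simp only [LinearMap.comp_apply, LinearMap.sub_apply, mulOp_apply, brk_apply, ← hb, ← hu,
      Algebra.algebraMap_self, RingHom.id_apply]
    rw [Units.eq_inv_mul_iff_mul_eq, mul_assoc]
    ring
  rw [this]
  exact ((h a).sub ((h s).mulRight _)).mulLeft _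

theorem extension_exists {A B : Type*} [CommRing A] [CommRing B] [Algebra K A] [Algebra K B]
    [Algebra A B] [IsScalarTower K A B] (S : Submonoid A) [IsLocalization S B] {n : ℕ}
    {δ : A →ₗ[K] B} (h : DiffLT n δ) :
    ∃ E : B →ₗ[K] B, DiffLT n E ∧ ∀ a : A, E (algebraMap A B a) = δ a := by
  let _ := precompModule K A B
  have smul_val : ∀ (c : A) (ε : diffTo K A B) (x : A), (c • ε).1 x = ε.1 (c * x) :=
    fun _ _ _ => rfl
  have tower : ∀ (k : K) (c : A) (ε : diffTo K A B), (k • c) • ε = k • (c • ε) := by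
    intro k c ε
    apply Subtype.ext; ext x
    change ε.1 ((k • c) * x) = k • ε.1 (c * x)
    rw [smul_mul_assoc, map_smul]
  have hunit : ∀ s : S, IsUnit (algebraMap A (Module.End A (diffTo K A B)) s) := by
    intro s
    rw [Module.End.isUnit_iff]
    have hs := IsLocalization.map_units B s
    constructor
    · rw [injective_iff_map_eq_zero]
      rintro ⟨ε, m, hε⟩ h0
      exact Subtype.ext (precomp_injective hε hs (congrArg Subtype.val h0))
    · rintro ⟨ε, m, hε⟩
      obtain ⟨η, hη, hη'⟩ := precomp_surjective hε hs
      exact ⟨⟨η, m, hη⟩, Subtype.ext hη'⟩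
  let L : diffTo K A B → (B →ₗ[A] diffTo K A B) := fun ε =>
    IsLocalizedModule.lift S (Algebra.linearMap A B) (LinearMap.toSpanSingleton A _ ε) hunit
  have hL : ∀ ε a, L ε (algebraMap A B a) = a • ε := fun ε a => by
    have := IsLocalizedModule.lift_apply S (Algebra.linearMap A B)
      (LinearMap.toSpanSingleton A _ ε) hunit a
    simpa using this
  have huniq : ∀ (ε : diffTo K A B) (l : B →ₗ[A] diffTo K A B), l 1 = ε → L ε = l := by
    intro ε l hl
    apply IsLocalizedModule.lift_unique
    ext
    simp [hl]
  let T : diffTo K A B → (B →ₗ[K] B) := fun ε =>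
    { toFun := fun x => (L ε x).1 1
      map_add' := fun x y => by rw [map_add]; rfl
      map_smul' := fun k x => by
        have : L ε (k • x) = k • L ε x := by
          rw [← algebraMap_smul A k x, map_smul, Algebra.algebraMap_eq_smul_one, tower, one_smul]
        rw [this]; rfl }
  have hT : ∀ ε x, T ε x = (L ε x).1 1 := fun _ _ => rfl
  have hTbrk : ∀ (ε : diffTo K A B) (c : A) (hc : brk ε.1 c ∈ diffTo K A B),
      brk (T ε) (algebraMap A B c) = T ⟨brk ε.1 c, hc⟩ := by
    intro ε c hc
    let l : B →ₗ[A] diffTo K A B :=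
      { toFun := fun x => c • L ε x -
          ⟨mulOp K (algebraMap A B c) ∘ₗ (L ε x).1, (L ε x).2.imp fun _ h => h.mulLeft _⟩
        map_add' := fun x y => by
          apply Subtype.ext; ext z
          simp [smul_add]
          ring
        map_smul' := fun a x => by
          apply Subtype.ext; ext z
          simp [smul_val, mul_left_comm] }
    have hl : L ⟨brk ε.1 c, hc⟩ = l := by
      apply huniq
      apply Subtype.ext; ext z
      have h1 : L ε 1 = ε := by rw [← map_one (algebraMap A B), hL, one_smul]
      simp [l, h1, smul_val]
    ext x
    rw [hT, hl, brk_apply, hT, hT, ← Algebra.smul_def, map_smul]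
    simp [l]
  have main : ∀ (n : ℕ) (ε : diffTo K A B), DiffLT n ε.1 → DiffLT n (T ε) := by
    intro n
    induction n with
    | zero =>
      intro ε hε
      have : ε = 0 := Subtype.ext hε
      have h0 : L ε = 0 := huniq _ _ (by rw [this]; rfl)
      change T ε = 0
      ext x
      rw [hT, h0]; rfl
    | succ n ih =>
      intro ε hε
      apply diffLT_of_brk_algebraMap S
      intro a
      rw [hTbrk ε a ⟨n, hε a⟩]
      exact ih _ (hε a)
  refine ⟨T ⟨δ, n, h⟩, main _ _ h, fun a => ?_⟩
  rw [hT, hL, smul_val, mul_one]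

theorem DiffLT.comp_algebraMap {A B : Type*} [CommRing A] [CommRing B] [Algebra K A]
    [Algebra K B] [Algebra A B] [IsScalarTower K A B] {n : ℕ} {δ : A →ₗ[K] A}
    (h : DiffLT n δ) : DiffLT n ((IsScalarTower.toAlgHom K A B).toLinearMap ∘ₗ δ) := by
  induction n generalizing δ with
  | zero => cases h; exact LinearMap.comp_zero _
  | succ n ih =>
    intro c
    convert ih (h c) using 1
    ext x; simp

/-- A differential operator on `A` has exactly one extension to a differential operator on a
localization `B` of `A`. -/
theorem existsUnique_extension {A B : Type*} [CommRing A] [CommRing B] [Algebra K A]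
    [Algebra K B] [Algebra A B] [IsScalarTower K A B] (S : Submonoid A) [IsLocalization S B]
    (δ : diffOps K A) :
    ∃! E : diffOps K B, ∀ a : A, E.1 (algebraMap A B a) = algebraMap A B (δ.1 a) := by
  obtain ⟨δ, n, h⟩ := δ
  obtain ⟨E, hE, hE'⟩ := extension_exists S (isDiffOp_iff_diffLT.1 h).comp_algebraMap (B := B)
  refine ⟨⟨E, n, isDiffOp_iff_diffLT.2 hE⟩, fun a => hE' a, ?_⟩
  rintro ⟨E', m, hm⟩ hE''
  have h1 : DiffLT (max (m + 1) (n + 1)) (E' - E) :=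
    ((isDiffOp_iff_diffLT.1 hm).mono (le_max_left _ _)).sub (hE.mono (le_max_right _ _))
  have h2 : E' - E = 0 := extension_unique S h1 fun a => by
    rw [LinearMap.sub_apply, hE', sub_eq_zero]
    exact hE'' a
  exact Subtype.ext (sub_eq_zero.1 h2)

/-- The unique extension `δ_g ∈ D_{A_g|K}` of `δ ∈ D_{A|K}`. The `D_{A|K}`-module structure on the
localization `A_g` is `(δ, v) ↦ δ_g v`. -/
noncomputable def localizeOp {A : Type*} [CommRing A] [Algebra K A] (g : A) (δ : diffOps K A) :
    diffOps K (Localization.Away g) :=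
  (existsUnique_extension (B := Localization.Away g) (Submonoid.powers g) δ).choose

end Localization

/-! ### The module `M^A[f^s]` and the exponent specialization maps -/

section FsModule

variable {A : Type*} [CommRing A] {ℓ : ℕ}

/-- The localization `A_{f₁⋯f_ℓ}`. -/
abbrev LocProd (f : Fin ℓ → A) : Type _ := Localization.Away (∏ i, f i)

/-- The free rank-one `A_{f₁⋯f_ℓ}[s₁,…,s_ℓ]`-module `M^A[f^s]` on the formal generator
`f₁^{s₁}⋯f_ℓ^{s_ℓ}`: the polynomial `h` stands for `h · f₁^{s₁}⋯f_ℓ^{s_ℓ}`. -/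
def FsModule (f : Fin ℓ → A) : Type _ := MvPolynomial (Fin ℓ) (LocProd f)

noncomputable instance (f : Fin ℓ → A) : AddCommGroup (FsModule f) :=
  inferInstanceAs (AddCommGroup (MvPolynomial (Fin ℓ) (LocProd f)))

noncomputable instance (f : Fin ℓ → A) : Module (MvPolynomial (Fin ℓ) (LocProd f)) (FsModule f) :=
  inferInstanceAs (Module (MvPolynomial (Fin ℓ) (LocProd f)) (MvPolynomial (Fin ℓ) (LocProd f)))

noncomputable instance (f : Fin ℓ → A) : Module (LocProd f) (FsModule f) :=
  inferInstanceAs (Module (LocProd f) (MvPolynomial (Fin ℓ) (LocProd f)))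

theorem isUnit_algebraMap_locProd (f : Fin ℓ → A) (i : Fin ℓ) :
    IsUnit (algebraMap A (LocProd f) (f i)) :=
  isUnit_of_dvd_unit (map_dvd _ (Finset.dvd_prod_of_mem f (Finset.mem_univ i)))
    (IsLocalization.Away.algebraMap_isUnit (∏ i, f i))

/-- The element `f₁^{t₁}⋯f_ℓ^{t_ℓ}` of `A_{f₁⋯f_ℓ}`, for integer exponents. -/
noncomputable def fPow (f : Fin ℓ → A) (t : Fin ℓ → ℤ) : LocProd f :=
  ((∏ i, (isUnit_algebraMap_locProd f i).unit ^ t i : (LocProd f)ˣ) : LocProd f)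

/-- The exponent specialization map `φ_t : M^A[f^s] → A_{f₁⋯f_ℓ}`,
`h(s) f₁^{s₁}⋯f_ℓ^{s_ℓ} ↦ h(t) f₁^{t₁}⋯f_ℓ^{t_ℓ}`. -/
noncomputable def specialize (f : Fin ℓ → A) (t : Fin ℓ → ℤ) :
    FsModule f →ₗ[LocProd f] LocProd f :=
  fPow f t • (MvPolynomial.aeval (R := LocProd f) fun i => (t i : LocProd f)).toLinearMap

end FsModule

/-! ### The ring `D_{A|K}[s₁,…,s_ℓ]` -/

section PolyOps

variable (K A : Type*) [Field K] [CommRing A] [Algebra K A] (ℓ : ℕ)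

/-- The polynomial ring `D_{A|K}[s₁,…,s_ℓ]` in commuting central variables over the
noncommutative ring `D_{A|K}`, as the algebra of the monoid `ℕ^ℓ` of exponents. -/
abbrev DiffOpsPoly : Type _ := AddMonoidAlgebra (diffOps K A) (Fin ℓ →₀ ℕ)

variable {K A ℓ}

/-- The value `δ(t) ∈ D_{A|K}` of `δ ∈ D_{A|K}[s₁,…,s_ℓ]` at an integer point `t`. -/
noncomputable def evalOp (t : Fin ℓ → ℤ) (δ : DiffOpsPoly K A ℓ) : diffOps K A :=
  δ.coeff.sum fun m d => (∏ i, t i ^ m i) • d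

end PolyOps

end BernsteinSato

namespace BernsteinSato

/-! ### Binomial expansion of integer powers of a unipotent operator -/

/-! The maps `φ_t` are jointly injective: a polynomial with coefficients in a `K`-algebra that
vanishes on `ℤ^ℓ` is zero in characteristic zero (`mvPolynomial_eq_zero_of_aeval_int`). Hence at
most one action is compatible with every `φ_t`, and the module axioms can be checked after
specialization, in `A_{f₁⋯f_ℓ}`.

What remains is to find, for given `δ` and `v`, an element whose specializations are `δ(t) • φ_t(v)`
(`exists_specialize_eq`). By linearity it is enough that `f^{-t} E(f^t b)` is polynomial in `t` for
a differential operator `E` on the localization. Conjugation by a unit `u` differs from the identity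
by `E ↦ u⁻¹[E, u]`, which lowers the order, so it is locally unipotent on differential operators.
Its `k`-th power is then the finite binomial sum `∑ choose k j • (conj - 1)^j`, valid for every
integer `k`, and `choose k j` is a polynomial in `k` over `K`. Treating the `f_i` one after another
gives `exists_mvPolynomial_aeval_eq_conj`. -/

theorem units_zpow_smul_eq_sum_choose {R M : Type*} [Ring R] [AddCommGroup M] [Module R M]
    (x : Rˣ) {n : ℕ} {v : M} (h : ((x : R) - 1) ^ n • v = 0) (k : ℤ) :
    ((x ^ k : Rˣ) : R) • v =
      ∑ j ∈ Finset.range n, Ring.choose k j • (((x : R) - 1) ^ j • v) := by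
  cases n with
  | zero =>
    have hv : v = 0 := by simpa using h
    simp [hv]
  | succ n =>
    -- Pascal's rule; the term pushed past the top index vanishes because `(x - 1) ^ (n + 1)` kills
    -- `v`.
    have step : ∀ k : ℤ, ∑ j ∈ Finset.range (n + 1), Ring.choose (k + 1) j •
        (((x : R) - 1) ^ j • v) = (x : R) • ∑ j ∈ Finset.range (n + 1), Ring.choose k j •
        (((x : R) - 1) ^ j • v) := by
      intro k
      have hN : ((x : R) - 1) • ∑ j ∈ Finset.range (n + 1), Ring.choose k j •
          (((x : R) - 1) ^ j • v) = ∑ j ∈ Finset.range n, Ring.choose k j •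
          (((x : R) - 1) ^ (j + 1) • v) := by
        rw [Finset.smul_sum, Finset.sum_range_succ]
        simp only [smul_comm _ (Ring.choose k _), ← mul_smul, ← pow_succ', h, smul_zero, add_zero]
      have hx : (x : R) = 1 + ((x : R) - 1) := by abel
      conv_rhs => rw [hx, add_smul, one_smul]
      -- The previous rewrite also expanded the inner occurrences of `x`; `← hx` restores them.
      rw [← hx, hN, Finset.sum_range_succ', Finset.sum_range_succ']
      simp only [Ring.choose_succ_succ, add_smul, Finset.sum_add_distrib, Ring.choose_zero_right]
      abel
    induction k using Int.induction_on with
    | zero =>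
      rw [Finset.sum_range_succ']
      simp [Ring.choose_zero_succ]
    | succ k ih => rw [step, ← ih, ← mul_smul, ← Units.val_mul, ← zpow_one_add, add_comm]
    | pred k ih =>
      -- For negative exponents the recurrence is inverted by applying `x⁻¹`.
      have h1 := step (-(k : ℤ) - 1)
      rw [sub_add_cancel, ← ih] at h1
      have h2 := congrArg (fun w => ((x⁻¹ : Rˣ) : R) • w) h1
      simp only [← mul_smul, ← Units.val_mul, inv_mul_cancel, Units.val_one, one_smul] at h2
      rw [← h2, ← zpow_neg_one, ← zpow_add]
      congr 3
      ring

/-- The falling factorial divided by `j!`, which is invertible in characteristic zero. -/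
theorem exists_polynomial_eval_eq_choose (K : Type*) [Field K] [CharZero K] (j : ℕ) :
    ∃ p : Polynomial K, ∀ k : ℤ, p.eval (k : K) = (Ring.choose k j : ℤ) := by
  refine ⟨Polynomial.C ((j.factorial : K)⁻¹) * descPochhammer K j, fun k => ?_⟩
  have h := Ring.descPochhammer_eq_factorial_smul_choose k j
  rw [← Polynomial.eval_eq_smeval, nsmul_eq_mul] at h
  have h' : (descPochhammer K j).eval (k : K) = ((j.factorial : ℤ) * Ring.choose k j : ℤ) := by
    rw [← descPochhammer_map (Int.castRingHom K), Polynomial.eval_intCast_map, ← h]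
    simp
  rw [Polynomial.eval_mul, Polynomial.eval_C, h']
  push_cast
  rw [inv_mul_cancel_left₀]
  exact_mod_cast j.factorial_ne_zero

/-! ### Polynomial functions on the lattice of exponents -/

/-- The functions `ℤ^ℓ → V` that are polynomial with coefficients in `D`. -/
def polyFun (K : Type*) {V : Type*} [Field K] [AddCommGroup V] [Module K V] (ℓ : ℕ)
    (D : Submodule K V) : Submodule K ((Fin ℓ → ℤ) → V) :=
  Submodule.span K {g | ∃ p : MvPolynomial (Fin ℓ) K, ∃ v ∈ D,
    g = fun t => MvPolynomial.eval (fun i => (t i : K)) p • v}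

theorem polyFun.smul {K V : Type*} [Field K] [AddCommGroup V] [Module K V] {ℓ : ℕ}
    {D : Submodule K V} (p : MvPolynomial (Fin ℓ) K) {g : (Fin ℓ → ℤ) → V}
    (hg : g ∈ polyFun K ℓ D) :
    (fun t => MvPolynomial.eval (fun i => (t i : K)) p • g t) ∈ polyFun K ℓ D := by
  induction hg using Submodule.span_induction with
  | mem g hg =>
    obtain ⟨q, v, hv, rfl⟩ := hg
    refine Submodule.subset_span ⟨p * q, v, hv, ?_⟩
    simp [mul_smul]
  | zero =>
    convert (polyFun K ℓ D).zero_mem using 1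
    ext t
    simp
  | add g h _ _ ihg ihh => simpa [smul_add] using! (polyFun K ℓ D).add_mem ihg ihh
  | smul c g _ ih =>
    convert (polyFun K ℓ D).smul_mem c ih using 1
    ext t
    exact smul_comm _ _ _

/-- On each vector of `D` the binomial expansion is finite, and its coefficients are polynomials in
`t i`. Closure of the class of polynomial functions is what lets the variables be treated one at a
time. -/
theorem polyFun_zpow_smul {K V : Type*} [Field K] [CharZero K] [AddCommGroup V] [Module K V]
    {ℓ : ℕ} {D : Submodule K V} (x : (Module.End K V)ˣ)
    (hD : ∀ v ∈ D, ((x : Module.End K V) - 1) v ∈ D)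
    (hnil : ∀ v ∈ D, ∃ n : ℕ, (((x : Module.End K V) - 1) ^ n : Module.End K V) v = 0) (i : Fin ℓ)
    {g : (Fin ℓ → ℤ) → V} (hg : g ∈ polyFun K ℓ D) :
    (fun t => ((x ^ t i : (Module.End K V)ˣ) : Module.End K V) (g t)) ∈ polyFun K ℓ D := by
  induction hg using Submodule.span_induction with
  | mem g hg =>
    obtain ⟨q, v, hv, rfl⟩ := hg
    obtain ⟨n, hn⟩ := hnil v hv
    have hpow : ∀ j : ℕ, (((x : Module.End K V) - 1) ^ j : Module.End K V) v ∈ D := by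
      intro j
      induction j with
      | zero => simpa using hv
      | succ j ih => rw [pow_succ', Module.End.mul_apply]; exact hD _ ih
    have key : ∀ k : ℤ, ((x ^ k : (Module.End K V)ˣ) : Module.End K V) v =
        ∑ j ∈ Finset.range n, Ring.choose k j • (((x : Module.End K V) - 1) ^ j : Module.End K V) v :=
      fun k => units_zpow_smul_eq_sum_choose x hn k
    simp only [map_smul]
    -- The scalar `q(t)` passes through the linear operator, so only the constant vector `v` needs
    -- expanding.
    refine polyFun.smul q (g := fun t => ((x ^ t i : (Module.End K V)ˣ) : Module.End K V) v) ?_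
    simp only [key]
    have hsum : (fun t : Fin ℓ → ℤ => ∑ j ∈ Finset.range n,
        Ring.choose (t i) j • (((x : Module.End K V) - 1) ^ j : Module.End K V) v) =
        ∑ j ∈ Finset.range n, fun t : Fin ℓ → ℤ =>
          Ring.choose (t i) j • (((x : Module.End K V) - 1) ^ j : Module.End K V) v := by
      ext t
      simp
    rw [hsum]
    refine Submodule.sum_mem _ fun j _ => ?_
    obtain ⟨p, hp⟩ := exists_polynomial_eval_eq_choose K j
    refine Submodule.subset_span ⟨Polynomial.aeval (MvPolynomial.X i) p, _, hpow j, ?_⟩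
    ext t
    have : MvPolynomial.eval (fun i => (t i : K)) (Polynomial.aeval (MvPolynomial.X i) p) =
        p.eval (t i : K) := by
      rw [← MvPolynomial.coe_aeval_eq_eval, RingHom.coe_coe, ← Polynomial.aeval_algHom_apply]
      simp
    rw [this, hp, Int.cast_smul_eq_zsmul]
  | zero =>
    convert (polyFun K ℓ D).zero_mem using 1
    ext t
    simp
  | add g h _ _ ihg ihh => simpa using! (polyFun K ℓ D).add_mem ihg ihh
  | smul c g _ ih => simpa using! (polyFun K ℓ D).smul_mem c ih

/-! ### Conjugation of differential operators by units -/

section Conj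

variable {K B : Type*} [Field K] [CommRing B] [Algebra K B]

variable (K) in
/-- Conjugation `E ↦ u⁻¹ E u` of endomorphisms by multiplication by a unit. -/
def conjOp : Bˣ →* (Module.End K (Module.End K B))ˣ :=
  MonoidHom.toHomUnits
    { toFun := fun u => LinearMap.mulLeft K (mulOp K ((u⁻¹ : Bˣ) : B)) *
        LinearMap.mulRight K (mulOp K (u : B))
      map_one' := by
        ext E x
        simp
      map_mul' := fun u w => by
        ext E x
        simp [mul_assoc, mul_left_comm] }

theorem conjOp_apply (u : Bˣ) (E : Module.End K B) (x : B) :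
    (conjOp K u : Module.End K (Module.End K B)) E x = (u⁻¹ : Bˣ) * E (u * x) := by
  simp [conjOp]

/-- `u⁻¹Eu - E = u⁻¹(Eu - uE)`: conjugation minus the identity is a commutator up to a unit, so it
lowers the order. -/
theorem conjOp_sub_one_apply (u : Bˣ) (E : Module.End K B) :
    ((conjOp K u : Module.End K (Module.End K B)) - 1) E =
      mulOp K ((u⁻¹ : Bˣ) : B) ∘ₗ brk E (u : B) := by
  ext x
  simp [conjOp_apply, mul_sub]

theorem conjOp_sub_one_pow_apply {n : ℕ} (u : Bˣ) {E : Module.End K B} (hE : DiffLT n E) :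
    (((conjOp K u : Module.End K (Module.End K B)) - 1) ^ n) E = 0 := by
  induction n generalizing E with
  | zero => exact hE
  | succ n ih =>
    rw [pow_succ, Module.End.mul_apply, conjOp_sub_one_apply]
    exact ih ((hE _).mulLeft _)

theorem conjOp_prod_mem_polyFun [CharZero K] {ℓ : ℕ} (u : Fin ℓ → Bˣ) {E : Module.End K B}
    (hE : E ∈ diffTo K B B) :
    (fun t : Fin ℓ → ℤ => (conjOp K (∏ i, u i ^ t i) : Module.End K (Module.End K B)) E) ∈
      polyFun K ℓ (diffTo K B B) := by
  -- Induction on the set of variables already conjugated by; `conjOp` turns the product of units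
  -- into a composition.
  suffices h : ∀ s : Finset (Fin ℓ), (fun t : Fin ℓ → ℤ =>
      (conjOp K (∏ i ∈ s, u i ^ t i) : Module.End K (Module.End K B)) E) ∈
      polyFun K ℓ (diffTo K B B) from h _
  intro s
  induction s using Finset.induction_on with
  | empty => exact Submodule.subset_span ⟨1, E, hE, by simp⟩
  | insert i s hi ih =>
    have hD : ∀ v ∈ diffTo K B B,
        ((conjOp K (u i) : Module.End K (Module.End K B)) - 1) v ∈ diffTo K B B := by
      rintro v ⟨n, hn⟩
      rw [conjOp_sub_one_apply]
      exact ⟨n, (hn.succ _).mulLeft _⟩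
    have hnil : ∀ v ∈ diffTo K B B, ∃ n : ℕ, (((conjOp K (u i) :
        Module.End K (Module.End K B)) - 1) ^ n : Module.End K (Module.End K B)) v = 0 := by
      rintro v ⟨n, hn⟩
      exact ⟨n, conjOp_sub_one_pow_apply _ hn⟩
    have := polyFun_zpow_smul (conjOp K (u i)) hD hnil i ih
    simpa [Finset.prod_insert hi] using! this

/-- For a differential operator `E`, the element `u^{-t} E (u^t b)` is polynomial in `t`. -/
theorem exists_mvPolynomial_aeval_eq_conj [CharZero K] {ℓ : ℕ} (u : Fin ℓ → Bˣ)
    {E : Module.End K B} (hE : E ∈ diffTo K B B) (b : B) :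
    ∃ P : MvPolynomial (Fin ℓ) B, ∀ t : Fin ℓ → ℤ,
      ((∏ i, u i ^ t i : Bˣ) : B) * MvPolynomial.aeval (fun i => (t i : B)) P =
        E (((∏ i, u i ^ t i : Bˣ) : B) * b) := by
  -- Evaluating an operator-valued polynomial function at `b` gives a polynomial with coefficients
  -- in `B`.
  suffices h : ∀ g ∈ polyFun K ℓ (diffTo K B B), ∃ P : MvPolynomial (Fin ℓ) B,
      ∀ t : Fin ℓ → ℤ, MvPolynomial.aeval (fun i => (t i : B)) P = g t b by
    obtain ⟨P, hP⟩ := h _ (conjOp_prod_mem_polyFun u hE)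
    refine ⟨P, fun t => ?_⟩
    rw [hP, conjOp_apply, Units.mul_inv_cancel_left]
  intro g hg
  induction hg using Submodule.span_induction with
  | mem g hg =>
    obtain ⟨q, v, hv, rfl⟩ := hg
    refine ⟨MvPolynomial.C (v b) * MvPolynomial.map (algebraMap K B) q, fun t => ?_⟩
    have : (fun i => (t i : B)) = fun i => algebraMap K B (t i : K) := by simp
    rw [map_mul, MvPolynomial.aeval_C, MvPolynomial.aeval_map_algebraMap, this]
    have h2 := MvPolynomial.aeval_algebraMap_apply B (fun i => (t i : K)) q
    simp only [Function.comp_def] at h2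
    rw [h2, LinearMap.smul_apply, Algebra.smul_def, mul_comm, MvPolynomial.aeval_eq_eval]
    simp
  | zero => exact ⟨0, by simp⟩
  | add g h _ _ ihg ihh =>
    obtain ⟨P, hP⟩ := ihg
    obtain ⟨Q, hQ⟩ := ihh
    exact ⟨P + Q, fun t => by rw [map_add, hP, hQ]; rfl⟩
  | smul c g _ ih =>
    obtain ⟨P, hP⟩ := ih
    exact ⟨MvPolynomial.C (algebraMap K B c) * P, fun t => by
      rw [map_mul, hP, MvPolynomial.aeval_C, Pi.smul_apply, LinearMap.smul_apply,
        Algebra.smul_def, Algebra.algebraMap_self, RingHom.id_apply]⟩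

/-- A polynomial over a `K`-algebra that vanishes at all integer points is zero. -/
theorem mvPolynomial_eq_zero_of_aeval_int [CharZero K] {ℓ : ℕ} {P : MvPolynomial (Fin ℓ) B}
    (h : ∀ t : Fin ℓ → ℤ, MvPolynomial.aeval (fun i => (t i : B)) P = 0) : P = 0 := by
  ext m
  -- `K`-linear functionals separate the elements of `B`. Applying one to the coefficients yields a
  -- polynomial over the field `K` that vanishes on the infinite grid `ℤ^ℓ`.
  rw [MvPolynomial.coeff_zero, ← Module.forall_dual_apply_eq_zero_iff K]
  intro φ
  let Q : MvPolynomial (Fin ℓ) K := ∑ d ∈ P.support, MvPolynomial.monomial d (φ (P.coeff d))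
  have hQ : Q = 0 := by
    refine MvPolynomial.funext_set (fun _ => Set.range ((↑) : ℤ → K))
      (fun _ => Set.infinite_range_of_injective Int.cast_injective) fun x hx => ?_
    choose t ht using fun i => hx i (Set.mem_univ i)
    obtain rfl : (fun i => (t i : K)) = x := funext ht
    have h1 := congrArg φ (h t)
    rw [MvPolynomial.aeval_def, MvPolynomial.eval₂_eq', map_sum, map_zero] at h1
    rw [map_zero, ← h1, map_sum]
    refine Finset.sum_congr rfl fun d _ => ?_
    have : (algebraMap B B) (MvPolynomial.coeff d P) * ∏ i, (t i : B) ^ d i =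
        (∏ i, (t i : K) ^ d i) • MvPolynomial.coeff d P := by
      rw [Algebra.smul_def, mul_comm]
      simp
    rw [this, map_smul, MvPolynomial.eval_monomial, Finsupp.prod_fintype _ _ (by simp),
      smul_eq_mul, mul_comm]
  have := congrArg (MvPolynomial.coeff m) hQ
  simp only [Q, MvPolynomial.coeff_sum, MvPolynomial.coeff_monomial, Finset.sum_ite_eq',
    MvPolynomial.coeff_zero] at this
  by_cases hm : m ∈ P.support
  · simpa [hm] using this
  · rw [MvPolynomial.notMem_support_iff.1 hm, map_zero]

end Conj

/-! ### Evaluation of `D_{A|K}[s₁,…,s_ℓ]` and localization as ring homomorphisms -/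

section

variable {K A : Type*} [Field K] [CommRing A] [Algebra K A] {ℓ : ℕ}

theorem localizeOp_apply_algebraMap (g : A) (δ : diffOps K A) (a : A) :
    (localizeOp g δ).1 (algebraMap A (Localization.Away g) a) =
      algebraMap A (Localization.Away g) (δ.1 a) :=
  (existsUnique_extension (B := Localization.Away g)
    (Submonoid.powers g) δ).choose_spec.1 a

/-- Uniqueness of the extension identifies the chosen operator; the ring homomorphism laws follow by
comparison on `A`. -/
theorem localizeOp_eq (g : A) (δ : diffOps K A) {E : diffOps K (Localization.Away g)}
    (h : ∀ a : A, E.1 (algebraMap A (Localization.Away g) a) =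
      algebraMap A (Localization.Away g) (δ.1 a)) : localizeOp g δ = E :=
  ((existsUnique_extension (B := Localization.Away g)
    (Submonoid.powers g) δ).choose_spec.2 E h).symm

variable (K) in
/-- Extension of differential operators to `A_g` as a ring homomorphism. -/
noncomputable def localizeOpHom (g : A) :
    diffOps K A →+* diffOps K (Localization.Away g) where
  toFun := localizeOp g
  map_one' := localizeOp_eq g _ fun _ => rfl
  map_zero' := localizeOp_eq g _ fun _ => by simp
  map_add' δ ε := localizeOp_eq g _ fun a => by
    simp [localizeOp_apply_algebraMap]
  map_mul' δ ε := localizeOp_eq g _ fun a => by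
    simp [localizeOp_apply_algebraMap]

theorem evalOp_single (t : Fin ℓ → ℤ) (m : Fin ℓ →₀ ℕ) (d : diffOps K A) :
    evalOp t (AddMonoidAlgebra.single m d : DiffOpsPoly K A ℓ) = (∏ i, t i ^ m i) • d := by
  simp [evalOp]

theorem evalOp_add (t : Fin ℓ → ℤ) (δ ε : DiffOpsPoly K A ℓ) :
    evalOp t (δ + ε) = evalOp t δ + evalOp t ε := by
  unfold evalOp
  rw [AddMonoidAlgebra.coeff_add]
  exact Finsupp.sum_add_index' (by simp) (by simp)

theorem evalOp_zero (t : Fin ℓ → ℤ) : evalOp t (0 : DiffOpsPoly K A ℓ) = 0 := by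
  simp [evalOp]

theorem evalOp_one (t : Fin ℓ → ℤ) : evalOp t (1 : DiffOpsPoly K A ℓ) = 1 := by
  rw [AddMonoidAlgebra.one_def, evalOp_single]
  simp

/-- On monomials this holds because the values `t^m` are integers, which commute with every
operator. -/
theorem evalOp_mul (t : Fin ℓ → ℤ) (δ ε : DiffOpsPoly K A ℓ) :
    evalOp t (δ * ε) = evalOp t δ * evalOp t ε := by
  induction δ using AddMonoidAlgebra.induction_linear with
  | zero => simp [evalOp_zero]
  | add δ δ' h h' => rw [add_mul, evalOp_add, h, h', evalOp_add, add_mul]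
  | single m d =>
    induction ε using AddMonoidAlgebra.induction_linear with
    | zero => simp [evalOp_zero]
    | add ε ε' h h' => rw [mul_add, evalOp_add, h, h', evalOp_add, mul_add]
    | single n e =>
      rw [AddMonoidAlgebra.single_mul_single, evalOp_single, evalOp_single, evalOp_single,
        smul_mul_smul_comm, ← Finset.prod_mul_distrib]
      simp [pow_add]

end

/-! ### The module structure on `M^A[f^s]` -/

section

variable {K A : Type*} [Field K] [CharZero K] [CommRing A] [Algebra K A] {ℓ : ℕ} (f : Fin ℓ → A)

theorem specialize_apply (t : Fin ℓ → ℤ) (v : MvPolynomial (Fin ℓ) (LocProd f)) :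
    specialize f t v = fPow f t * MvPolynomial.aeval (fun i => (t i : LocProd f)) v := rfl

/-- The factor `f^t` is a unit, so it cancels and leaves a polynomial vanishing at all integer
points. -/
theorem specialize_jointly_injective (K : Type*) {A : Type*} [Field K] [CharZero K] [CommRing A]
    [Algebra K A] {ℓ : ℕ} (f : Fin ℓ → A) {v w : FsModule f}
    (h : ∀ t, specialize f t v = specialize f t w) : v = w := by
  refine sub_eq_zero.1 (mvPolynomial_eq_zero_of_aeval_int (K := K) (B := LocProd f)
    (P := v - w) fun t => (Units.isUnit _).mul_left_cancel ((?_ : specialize f t (v - w) = _)))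
  rw [map_sub, h, sub_self, mul_zero]

theorem specialize_mvPolynomial_smul (t : Fin ℓ → ℤ) (p : MvPolynomial (Fin ℓ) (LocProd f))
    (v : FsModule f) :
    specialize f t (p • v) = MvPolynomial.aeval (fun i => (t i : LocProd f)) p *
      specialize f t v := by
  refine (congrArg (fPow f t * ·) (map_mul (MvPolynomial.aeval _) p v)).trans ?_
  exact mul_left_comm _ _ _

theorem exists_specialize_eq (δ : DiffOpsPoly K A ℓ) (v : FsModule f) :
    ∃ w : FsModule f, ∀ t, specialize f t w =
      (localizeOp (∏ i, f i) (evalOp t δ)).1 (specialize f t v) := by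
  induction δ using AddMonoidAlgebra.induction_linear with
  | zero =>
    refine ⟨0, fun t => ?_⟩
    rw [evalOp_zero, map_zero]
    exact (LinearMap.congr_fun (congrArg Subtype.val
      ((localizeOpHom K (∏ i, f i)).map_zero)) _).symm
  | add δ ε h h' =>
    obtain ⟨w, hw⟩ := h
    obtain ⟨w', hw'⟩ := h'
    refine ⟨w + w', fun t => ?_⟩
    rw [evalOp_add, map_add, hw, hw']
    exact (LinearMap.congr_fun (congrArg Subtype.val
      ((localizeOpHom K (∏ i, f i)).map_add _ _)) _).symm
  | single m d =>
    obtain ⟨n, hn⟩ := (localizeOp (∏ i, f i) d).2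
    have hE : (localizeOp (∏ i, f i) d).1 ∈ diffTo K (LocProd f) (LocProd f) :=
      -- `IsDiffOp` bounds the order by `≤ n`, `DiffLT` by `< n + 1`.
      ⟨n + 1, isDiffOp_iff_diffLT.1 hn⟩
    have hloc : ∀ t : Fin ℓ → ℤ, localizeOp (∏ i, f i)
        (evalOp t (AddMonoidAlgebra.single m d : DiffOpsPoly K A ℓ)) =
        (∏ i, t i ^ m i) • localizeOp (∏ i, f i) d := fun t => by
      rw [evalOp_single]
      exact map_zsmul (localizeOpHom K (∏ i, f i)) _ _
    -- The factor `s^m` specializes to the integer `t^m`, so it can be restored afterwards by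
    -- multiplying `w`.
    suffices h : ∃ w : FsModule f, ∀ t, specialize f t w =
        (localizeOp (∏ i, f i) d).1 (specialize f t v) by
      obtain ⟨w, hw⟩ := h
      refine ⟨(MvPolynomial.monomial m (1 : LocProd f) • w : FsModule f), fun t => ?_⟩
      rw [hloc, specialize_mvPolynomial_smul, hw, MvPolynomial.aeval_monomial,
        Finsupp.prod_fintype _ _ (by simp)]
      simp [zsmul_eq_mul]
    refine MvPolynomial.induction_on (motive := fun v : MvPolynomial (Fin ℓ) (LocProd f) =>
      ∃ w : FsModule f, ∀ t, specialize f t w = (localizeOp (∏ i, f i) d).1 (specialize f t v))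
      v (fun b => ?_) (fun p q hp hq => ?_) (fun p i hp => ?_)
    · obtain ⟨P, hP⟩ := exists_mvPolynomial_aeval_eq_conj
        (fun i => (isUnit_algebraMap_locProd f i).unit) hE b
      refine ⟨P, fun t => ?_⟩
      rw [specialize_apply, specialize_apply, MvPolynomial.aeval_C]
      exact hP t
    · obtain ⟨w, hw⟩ := hp
      obtain ⟨w', hw'⟩ := hq
      refine ⟨w + w', fun t => ?_⟩
      rw [map_add, hw, hw', specialize_apply f t (p + q), map_add, mul_add, map_add]
      rfl
    · obtain ⟨w, hw⟩ := hp
      refine ⟨(MvPolynomial.X i : MvPolynomial (Fin ℓ) (LocProd f)) • w, fun t => ?_⟩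
      -- `s_i` becomes the integer `t i`, which every additive map respects; multiplication by `s_i`
      -- thus carries over from `v` to `w`.
      have hX : specialize f t (p * MvPolynomial.X i : MvPolynomial (Fin ℓ) (LocProd f)) =
          t i • specialize f t p := by
        rw [mul_comm, ← smul_eq_mul]
        refine (specialize_mvPolynomial_smul f t _ p).trans ?_
        rw [MvPolynomial.aeval_X, zsmul_eq_mul]
      rw [specialize_mvPolynomial_smul, hw, MvPolynomial.aeval_X, hX, map_zsmul, zsmul_eq_mul]

/-- The action of `D_{A|K}[s₁,…,s_ℓ]` on `M^A[f^s]`. -/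
noncomputable def fsSMul (δ : DiffOpsPoly K A ℓ) (v : FsModule f) : FsModule f :=
  (exists_specialize_eq f δ v).choose

theorem specialize_fsSMul (δ : DiffOpsPoly K A ℓ) (v : FsModule f) (t : Fin ℓ → ℤ) :
    specialize f t (fsSMul f δ v) =
      (localizeOpHom K (∏ i, f i) (evalOp t δ)).1 (specialize f t v) :=
  (exists_specialize_eq f δ v).choose_spec t

variable (K) in
/-- The `D_{A|K}[s₁,…,s_ℓ]`-module structure on `M^A[f^s]`. -/
@[reducible] noncomputable def fsModule : Module (DiffOpsPoly K A ℓ) (FsModule f) where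
  smul := fsSMul f
  -- Each axiom is tested under all `φ_t`, where it reduces to additivity or to the ring
  -- homomorphism laws of `evalOp` and `localizeOpHom`.
  one_smul v := specialize_jointly_injective K f fun t => by
    refine (specialize_fsSMul f 1 v t).trans ?_
    rw [evalOp_one, map_one]
    rfl
  mul_smul δ ε v := specialize_jointly_injective K f fun t => by
    refine (specialize_fsSMul f (δ * ε) v t).trans ?_
    refine Eq.trans ?_ (specialize_fsSMul f δ (fsSMul f ε v) t).symm
    rw [evalOp_mul, map_mul, specialize_fsSMul]
    rfl
  smul_zero δ := specialize_jointly_injective K f fun t => by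
    refine (specialize_fsSMul f δ 0 t).trans ?_
    rw [map_zero, map_zero]
  smul_add δ v w := specialize_jointly_injective K f fun t => by
    refine (specialize_fsSMul f δ (v + w) t).trans ?_
    rw [map_add, map_add, ← specialize_fsSMul, ← specialize_fsSMul, ← map_add]
    rfl
  add_smul δ ε v := specialize_jointly_injective K f fun t => by
    refine (specialize_fsSMul f (δ + ε) v t).trans ?_
    rw [evalOp_add, map_add]
    refine (congrArg₂ (· + ·) (specialize_fsSMul f δ v t).symm
      (specialize_fsSMul f ε v t).symm).trans ?_
    rw [← map_add]
    rfl
  zero_smul v := specialize_jointly_injective K f fun t => by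
    refine (specialize_fsSMul f 0 v t).trans ?_
    rw [evalOp_zero, map_zero, map_zero]
    rfl

end

end BernsteinSato

theorem mainTheorem1 {K A : Type*} [Field K] [CharZero K] [CommRing A] [Algebra K A]
    (hA : Algebra.FiniteType K A ∨
      ∃ _ : IsLocalRing A, IsAdicComplete (IsLocalRing.maximalIdeal A) A)
    {ℓ : ℕ} (f : Fin ℓ → A) :
    ∃! inst : Module (BernsteinSato.DiffOpsPoly K A ℓ) (BernsteinSato.FsModule f),
      ∀ (v : BernsteinSato.FsModule f) (δ : BernsteinSato.DiffOpsPoly K A ℓ) (t : Fin ℓ → ℤ),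
        BernsteinSato.specialize f t (inst.smul δ v) =
          (BernsteinSato.localizeOp (∏ i, f i) (BernsteinSato.evalOp t δ)).1
            (BernsteinSato.specialize f t v) := by
  refine ⟨BernsteinSato.fsModule K f, fun v δ t => (BernsteinSato.exists_specialize_eq f δ v).choose_spec t,
    fun inst h => Module.ext' _ _ fun δ v => ?_⟩
  -- Any compatible structure has the same specializations as the constructed one, hence the same
  -- scalar multiplication.
  exact BernsteinSato.specialize_jointly_injective K f fun t =>
    (h v δ t).trans (BernsteinSato.specialize_fsSMul f δ v t).symm
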